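/- A Nelson algebra $(A,\vee,\wedge,\to,{\sim},0,1)$ is a bounded distributive lattice with operations ${\sim}$ and $\to$ such that for all $a,b,c\in A$: ${\sim}{\sim}a=a$; $a\le b$ iff ${\sim}b\le{\sim}a$; $a\wedge{\sim}a\le b\vee{\sim}b$; $a\wedge c\le{\sim}a\vee b$ iff $c\le a\to b$; and $(a\wedge b)\to c=a\to(b\to c)$. For a quasiorder (reflexive and transitive relation) $R$ on a set $U$ put $R(x)=\{y\mid x\,R\,y\}$ and, for $X\subseteq U$, $X_R=\{x\mid R(x)\subseteq X\}$ and $X^R=\{x\mid R(x)\cap X\ne\emptyset\}$. The set $\mathit{IRS}_R(U)=\{(X_R,X^R)\mid X\subseteq U\}$, ordered by componentwise inclusion, is a Nelson algebra $\mathbb{IRS}_R(U)$, with componentwise unions and intersections as joins and meets, ${\sim}(C,D)=(-D,-C)$ and $(C,D)\to(C',D')=((-C\cup C')_R,\,-C\cup D')$, where $-$ is the complement in $U$. Let $S=\{x\in U\mid R(x)=\{x\}\}$, and let $\mathcal T_R(U)=\{X_R\mid X\subseteq U\}$, a Heyting algebra under inclusion with $X\Rightarrow Y=(-X\cup Y)_R$.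 We say that $\mathbb{IRS}_R(U)$ is an effective lattice if the relation $X\cong_S Y\iff X\cap S=Y\cap S$ is the Glivenko congruence of $\mathcal T_R(U)$, that is, its least congruence whose quotient is a Boolean algebra. An algebraic lattice is a complete lattice in which each element is a join of compact elements; an element $x$ of a complete lattice is completely join-irreducible if $x=\bigvee X$ implies $x\in X$ for every subset $X$. If $A$ is a Nelson algebra whose underlying lattice is algebraic, put $g(j)=\bigwedge\{x\in A\mid x\nleq{\sim}j\}$ for each completely join-irreducible $j\in A$. Theorem. Let $A$ be a Nelson algebra. There exist a set $U$ and a quasiorder $R$ on $U$ such that $\mathbb{IRS}_R(U)$ is an effective lattice and $A\cong\mathbb{IRS}_R(U)$ as Nelson algebras if and only if the underlying lattice of $A$ is an algebraic lattice in which each completely join-irreducible element $j$ is comparable with at least one completely join-irreducible element $k$ such that $g(k)=k$. -/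

import Mathlib

universe u v

/-! ### Nelson algebras -/

/-- A Nelson algebra `(A, ∨, ∧, →, ∼, 0, 1)`: a Kleene algebra `(A, ∨, ∧, ∼, 0, 1)`, that is, a
bounded distributive lattice with a strong negation `∼ = snot` subject to the first three laws,
together with a weak relative pseudocomplementation `→ = wimp` subject to the last two laws. -/
class NelsonAlgebra (A : Type u) extends DistribLattice A, BoundedOrder A where
  /-- strong negation `∼` -/
  snot : A → A
  /-- weak relative pseudocomplementation `→` -/
  wimp : A → A → A
  snot_snot : ∀ a : A, snot (snot a) = a
  le_iff_snot_le_snot : ∀ a b : A, a ≤ b ↔ snot b ≤ snot a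
  inf_snot_le_sup_snot : ∀ a b : A, a ⊓ snot a ≤ b ⊔ snot b
  inf_le_snot_sup_iff : ∀ a b c : A, a ⊓ c ≤ snot a ⊔ b ↔ c ≤ wimp a b
  wimp_inf : ∀ a b c : A, wimp (a ⊓ b) c = wimp a (wimp b c)

open NelsonAlgebra in
/-- An isomorphism of Nelson algebras: a bijection that preserves all the operations. -/
structure NelsonEquiv (A : Type u) (B : Type v) [NelsonAlgebra A] [NelsonAlgebra B]
    extends A ≃ B where
  map_sup : ∀ a b : A, toFun (a ⊔ b) = toFun a ⊔ toFun b
  map_inf : ∀ a b : A, toFun (a ⊓ b) = toFun a ⊓ toFun b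
  map_wimp : ∀ a b : A, toFun (wimp a b) = wimp (toFun a) (toFun b)
  map_snot : ∀ a : A, toFun (snot a) = snot (toFun a)
  map_bot : toFun ⊥ = ⊥
  map_top : toFun ⊤ = ⊤

/-- The partially ordered set `A` is an algebraic lattice: it is a complete lattice (every subset
has a join, hence also a meet), and each element is the join of a set of compact elements. -/
def IsAlgebraicLattice (A : Type u) [PartialOrder A] : Prop :=
  (∀ s : Set A, ∃ a : A, IsLUB s a) ∧
    ∀ x : A, ∃ s : Set A, (∀ c ∈ s, IsCompactElement c) ∧ IsLUB s x

/-- `x` is completely join-irreducible: if `x` is the join of `X`, then `x ∈ X`. -/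
def IsCompletelyJoinIrreducible {A : Type u} [PartialOrder A] (x : A) : Prop :=
  ∀ X : Set A, IsLUB X x → x ∈ X

/-- `i = g(j)`, where `g(j) = ⋀ {x ∈ A ∣ x ≰ ∼j}`. -/
def IsNelsonG {A : Type u} [NelsonAlgebra A] (j i : A) : Prop :=
  IsGLB {x : A | ¬ x ≤ NelsonAlgebra.snot j} i

/-! ### Congruences on Heyting algebras -/

/-- A congruence on a Heyting algebra: an equivalence compatible with `∨`, `∧` and `⇒`. -/
structure IsHeytingCongruence {H : Type u} [HeytingAlgebra H] (θ : H → H → Prop) : Prop where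
  equivalence : Equivalence θ
  sup : ∀ a b c d : H, θ a b → θ c d → θ (a ⊔ c) (b ⊔ d)
  inf : ∀ a b c d : H, θ a b → θ c d → θ (a ⊓ c) (b ⊓ d)
  himp : ∀ a b c d : H, θ a b → θ c d → θ (a ⇨ c) (b ⇨ d)

/-- A Boolean congruence: the quotient, which is a Heyting algebra, is a Boolean algebra, that is,
each of its elements has a complement. -/
structure IsBooleanCongruence {H : Type u} [HeytingAlgebra H] (θ : H → H → Prop) : Prop
    extends IsHeytingCongruence θ where
  complemented : ∀ a : H, ∃ b : H, θ (a ⊓ b) ⊥ ∧ θ (a ⊔ b) ⊤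

/-- `θ` is the Glivenko congruence: the least Boolean congruence. -/
def IsGlivenkoCongruence {H : Type u} [HeytingAlgebra H] (θ : H → H → Prop) : Prop :=
  IsBooleanCongruence θ ∧
    ∀ η : H → H → Prop, IsBooleanCongruence η → ∀ a b : H, θ a b → η a b

/-! ### Rough sets -/

namespace RoughSet

variable {U : Type u}

/-- The lower approximation `X_R = {x ∣ R(x) ⊆ X}`. -/
def lower (R : U → U → Prop) (X : Set U) : Set U := {x | ∀ y, R x y → y ∈ X}

/-- The upper approximation `X^R = {x ∣ R(x) ∩ X ≠ ∅}`. -/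
def upper (R : U → U → Prop) (X : Set U) : Set U := {x | ∃ y, R x y ∧ y ∈ X}

/-- The set `S` of `R`-closed points: those `x` with `R(x) = {x}`. -/
def closedPoints (R : U → U → Prop) : Set U := {x | {y | R x y} = {x}}

/-- The set `T_R(U) = {X_R ∣ X ⊆ U}`, as a type. -/
def Opens (R : U → U → Prop) : Type u := {A : Set U // ∃ X : Set U, A = lower R X}

/-- The set `IRS_R(U) = {(X_R, X^R) ∣ X ⊆ U}`, as a type. -/
def IRS (R : U → U → Prop) : Type u :=
  {p : Set U × Set U // ∃ X : Set U, p = (lower R X, upper R X)}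

/-- The relation `≅_S` on `T_R(U)`: `X ≅_S Y` iff `X ∩ S = Y ∩ S`. -/
def congS (R : U → U → Prop) (X Y : Opens R) : Prop :=
  X.1 ∩ closedPoints R = Y.1 ∩ closedPoints R

section Quasiorder

variable (R : U → U → Prop) [IsPreorder U R]

theorem isOpen_iff (A : Set U) :
    (∃ X, A = lower R X) ↔ ∀ x ∈ A, ∀ y, R x y → y ∈ A := by
  constructor
  · rintro ⟨X, rfl⟩ x hx y hxy z hyz
    exact hx z (_root_.trans hxy hyz)
  · intro h
    refine ⟨A, Set.ext fun x => ⟨fun hx y hxy => h x hx y hxy, fun hx => hx x (refl_of R x)⟩⟩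

instance : PartialOrder (Opens R) := inferInstanceAs (PartialOrder (Subtype _))

/-- The Heyting algebra `T_R(U)`, ordered by inclusion: joins are unions, meets are
intersections, and `X ⇒ Y = (-X ∪ Y)_R`. -/
instance : HeytingAlgebra (Opens R) where
  sup A B := ⟨A.1 ∪ B.1, (isOpen_iff R _).2 (by
    have hA := (isOpen_iff R _).1 A.2
    have hB := (isOpen_iff R _).1 B.2
    rintro x (hx | hx) y hxy
    · exact Or.inl (hA x hx y hxy)
    · exact Or.inr (hB x hx y hxy))⟩
  inf A B := ⟨A.1 ∩ B.1, (isOpen_iff R _).2 (by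
    have hA := (isOpen_iff R _).1 A.2
    have hB := (isOpen_iff R _).1 B.2
    rintro x ⟨hx, hx'⟩ y hxy
    exact ⟨hA x hx y hxy, hB x hx' y hxy⟩)⟩
  top := ⟨Set.univ, (isOpen_iff R _).2 fun _ _ _ _ => trivial⟩
  bot := ⟨∅, (isOpen_iff R _).2 fun _ h _ _ => h.elim⟩
  himp A B := ⟨lower R (A.1ᶜ ∪ B.1), _, rfl⟩
  compl A := ⟨lower R (A.1ᶜ), _, rfl⟩
  le_sup_left A B := Set.subset_union_left (s := A.1) (t := B.1)
  le_sup_right A B := Set.subset_union_right (s := A.1) (t := B.1)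
  sup_le A B C h h' := Set.union_subset (s := A.1) (t := B.1) h h'
  inf_le_left A B := Set.inter_subset_left (s := A.1) (t := B.1)
  inf_le_right A B := Set.inter_subset_right (s := A.1) (t := B.1)
  le_inf A B C h h' := Set.subset_inter (r := A.1) (s := B.1) (t := C.1) h h'
  le_top A := Set.subset_univ A.1
  bot_le A := Set.empty_subset A.1
  le_himp_iff A B C := by
    have hA := (isOpen_iff R _).1 A.2
    constructor
    · rintro h x ⟨hx, hx'⟩
      exact (h hx x (refl_of R x)).resolve_left fun h' => h' hx'
    · intro h x hx y hxy
      by_cases hy : y ∈ B.1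
      · exact Or.inr (h ⟨hA x hx y hxy, hy⟩)
      · exact Or.inl hy
  himp_bot A := by
    refine Subtype.ext ?_
    change lower R (A.1ᶜ ∪ ∅) = lower R (A.1ᶜ)
    rw [Set.union_empty]

/-- `IRS_R(U)` is an effective lattice: `≅_S` is the Glivenko congruence of `T_R(U)`. -/
def IsEffective : Prop := IsGlivenkoCongruence (congS R)

variable {R}

/-- Above every point there are two disjoint mutually cofinal sets, if no point is `R`-closed. -/
theorem exists_alternating {Q : Set U} (hQ : ∀ x ∈ Q, ∀ y, R x y → y ∈ Q)
    (hne : ∀ x ∈ Q, ∃ y, R x y ∧ y ≠ x) {x : U} (hx : x ∈ Q) :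
    ∃ Y Z : Set U, Disjoint Y Z ∧ (∃ y ∈ Y, R x y) ∧ (∀ y ∈ Y, R x y) ∧ (∀ z ∈ Z, R x z) ∧
      (∀ y ∈ Y, ∃ z ∈ Z, R y z) ∧ (∀ z ∈ Z, ∃ y ∈ Y, R z y) := by
  by_cases h : ∃ y, R x y ∧ ∀ z, R y z → R z y
  · obtain ⟨y, hxy, hy⟩ := h
    obtain ⟨z, hyz, hzy⟩ := hne y (hQ x hx y hxy)
    refine ⟨{y}, {z}, by simpa using hzy.symm, ⟨y, rfl, hxy⟩, ?_, ?_, ?_, ?_⟩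
    · rintro _ rfl; exact hxy
    · rintro _ rfl; exact _root_.trans hxy hyz
    · rintro _ rfl; exact ⟨z, rfl, hyz⟩
    · rintro _ rfl; exact ⟨y, rfl, hy _ hyz⟩
  · push Not at h
    choose! f hf hf' using h
    set a : ℕ → U := fun n => f^[n] x with ha
    have hs : ∀ n, a (n + 1) = f (a n) := fun n => Function.iterate_succ_apply' f n x
    have hxa : ∀ n, R x (a n) := by
      intro n
      induction n with
      | zero => exact refl_of R x
      | succ n ih => rw [hs]; exact _root_.trans ih (hf _ ih)
    have hstep : ∀ n, R (a n) (a (n + 1)) := fun n => by rw [hs]; exact hf _ (hxa n)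
    have hle : ∀ m k, R (a m) (a (m + k)) := by
      intro m k
      induction k with
      | zero => exact refl_of R _
      | succ k ih => exact _root_.trans ih (hstep _)
    have hlt : ∀ m n, m < n → a m ≠ a n := by
      intro m n hmn he
      obtain ⟨k, rfl⟩ := Nat.exists_eq_add_of_lt hmn
      have h1 : R (a (m + 1)) (a m) := by
        rw [he, show m + k + 1 = (m + 1) + k by omega]; exact hle _ _
      rw [hs] at h1
      exact hf' _ (hxa m) h1
    have hinj : ∀ m n, a m = a n → m = n := by
      intro m n he
      rcases lt_trichotomy m n with h | h | h
      · exact (hlt _ _ h he).elim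
      · exact h
      · exact (hlt _ _ h he.symm).elim
    refine ⟨Set.range fun n => a (2 * n), Set.range fun n => a (2 * n + 1), ?_,
      ⟨a (2 * 0), ⟨0, rfl⟩, hxa _⟩, ?_, ?_, ?_, ?_⟩
    · rw [Set.disjoint_left]
      rintro _ ⟨m, rfl⟩ ⟨n, hn⟩
      have := hinj _ _ hn
      omega
    · rintro _ ⟨n, rfl⟩; exact hxa _
    · rintro _ ⟨n, rfl⟩; exact hxa _
    · rintro _ ⟨n, rfl⟩; exact ⟨_, ⟨n, rfl⟩, hstep _⟩
    · rintro _ ⟨n, rfl⟩; exact ⟨_, ⟨n + 1, rfl⟩, hstep _⟩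

/-- An `R`-closed set without `R`-closed points splits into two cofinal parts. -/
theorem exists_split {Q : Set U} (hQ : ∀ x ∈ Q, ∀ y, R x y → y ∈ Q)
    (hne : ∀ x ∈ Q, ∃ y, R x y ∧ y ≠ x) :
    ∃ Y ⊆ Q, ∀ x ∈ Q, (∃ y ∈ Y, R x y) ∧ ∃ z, z ∉ Y ∧ R x z := by
  obtain ⟨M, hM⟩ := zorn_le₀ {p : Set U × Set U | Disjoint p.1 p.2 ∧ p.1 ⊆ Q ∧
      (∀ y ∈ p.1, ∃ z ∈ p.2, R y z) ∧ (∀ z ∈ p.2, ∃ y ∈ p.1, R z y)} (by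
    intro c hc hchain
    refine ⟨(⋃ p ∈ c, p.1, ⋃ p ∈ c, p.2), ⟨?_, ?_, ?_, ?_⟩, ?_⟩
    · rw [Set.disjoint_left]
      intro x hx hx'
      simp only [Set.mem_iUnion] at hx hx'
      obtain ⟨p, hp, hxp⟩ := hx
      obtain ⟨q, hq, hxq⟩ := hx'
      rcases hchain.total hp hq with h | h
      · exact Set.disjoint_left.1 (hc hq).1 (h.1 hxp) hxq
      · exact Set.disjoint_left.1 (hc hp).1 hxp (h.2 hxq)
    · exact Set.iUnion₂_subset fun p hp => (hc hp).2.1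
    · intro y hy
      simp only [Set.mem_iUnion] at hy
      obtain ⟨p, hp, hyp⟩ := hy
      obtain ⟨z, hz, hyz⟩ := (hc hp).2.2.1 y hyp
      exact ⟨z, Set.mem_biUnion hp hz, hyz⟩
    · intro y hy
      simp only [Set.mem_iUnion] at hy
      obtain ⟨p, hp, hyp⟩ := hy
      obtain ⟨z, hz, hyz⟩ := (hc hp).2.2.2 y hyp
      exact ⟨z, Set.mem_biUnion hp hz, hyz⟩
    · intro p hp
      exact ⟨Set.subset_biUnion_of_mem (u := fun p : Set U × Set U => p.1) hp,
        Set.subset_biUnion_of_mem (u := fun p : Set U × Set U => p.2) hp⟩)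
  obtain ⟨⟨hd, hsub, h12, h21⟩, hmax⟩ := hM
  have key : ∀ x ∈ Q, ∃ y ∈ M.1, R x y := by
    intro x hx
    by_contra hcon
    push Not at hcon
    have hcon2 : ∀ z ∈ M.2, ¬ R x z := fun z hz hxz => by
      obtain ⟨y, hy, hzy⟩ := h21 z hz
      exact hcon y hy (_root_.trans hxz hzy)
    obtain ⟨Y, Z, hYZ, ⟨y₀, hy₀, hxy₀⟩, hY, hZ, hYZ', hZY'⟩ := exists_alternating hQ hne hx
    have hle : (M.1 ∪ Y, M.2 ∪ Z) ≤ M := hmax (y := (M.1 ∪ Y, M.2 ∪ Z)) (by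
      refine ⟨?_, ?_, ?_, ?_⟩
      · rw [Set.disjoint_left]
        rintro w (hw | hw) (hw' | hw')
        · exact Set.disjoint_left.1 hd hw hw'
        · exact hcon w hw (hZ w hw')
        · exact hcon2 w hw' (hY w hw)
        · exact Set.disjoint_left.1 hYZ hw hw'
      · exact Set.union_subset hsub fun y hy => hQ x hx y (hY y hy)
      · rintro w (hw | hw)
        · obtain ⟨z, hz, h⟩ := h12 w hw
          exact ⟨z, Or.inl hz, h⟩
        · obtain ⟨z, hz, h⟩ := hYZ' w hw
          exact ⟨z, Or.inr hz, h⟩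
      · rintro w (hw | hw)
        · obtain ⟨z, hz, h⟩ := h21 w hw
          exact ⟨z, Or.inl hz, h⟩
        · obtain ⟨z, hz, h⟩ := hZY' w hw
          exact ⟨z, Or.inr hz, h⟩)
      ⟨Set.subset_union_left, Set.subset_union_left⟩
    exact hcon y₀ (hle.1 (Or.inr hy₀)) hxy₀
  refine ⟨M.1, hsub, fun x hx => ⟨key x hx, ?_⟩⟩
  obtain ⟨y, hy, hxy⟩ := key x hx
  obtain ⟨z, hz, hyz⟩ := h12 y hy
  exact ⟨z, fun h => Set.disjoint_left.1 hd h hz, _root_.trans hxy hyz⟩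

/-- The pairs in `IRS_R(U)` are the pairs `(A, B) ∈ T_R(U) × T^R(U)` with `A ⊆ B` and
`S ⊆ A ∪ -B`. -/
theorem mem_IRS_iff (p : Set U × Set U) :
    (∃ X, p = (lower R X, upper R X)) ↔
      (∀ x ∈ p.1, ∀ y, R x y → y ∈ p.1) ∧ (∀ y ∈ p.2, ∀ x, R x y → x ∈ p.2) ∧ p.1 ⊆ p.2 ∧
        ∀ x ∈ closedPoints R, x ∈ p.2 → x ∈ p.1 := by
  constructor
  · rintro ⟨X, rfl⟩
    refine ⟨fun x hx y hxy z hyz => hx z (_root_.trans hxy hyz), ?_, ?_, ?_⟩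
    · rintro y ⟨z, hyz, hz⟩ x hxy
      exact ⟨z, _root_.trans hxy hyz, hz⟩
    · intro x hx
      exact ⟨x, refl_of R x, hx x (refl_of R x)⟩
    · rintro x hS ⟨y, hxy, hy⟩ z hxz
      have h1 : y ∈ ({x} : Set U) := by rw [← hS]; exact hxy
      have h2 : z ∈ ({x} : Set U) := by rw [← hS]; exact hxz
      rw [Set.mem_singleton_iff] at h1 h2
      rw [h2, ← h1]; exact hy
  · obtain ⟨A, B⟩ := p
    rintro ⟨hA, hB, hAB, hS⟩
    dsimp only at hA hB hAB hS
    obtain ⟨Y, hYQ, hY⟩ := exists_split (R := R)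
      (Q := {x | ∀ y, R x y → y ∈ B ∧ y ∉ A}) (fun x hx y hxy z hyz =>
        hx z (_root_.trans hxy hyz)) (by
      intro x hx
      by_contra hcon
      push Not at hcon
      have hxS : x ∈ closedPoints R := by
        ext y
        exact ⟨fun h => hcon y h, fun h => by
          rw [Set.mem_singleton_iff] at h; rw [h]; exact refl_of R x⟩
      have := hx x (refl_of R x)
      exact this.2 (hS x hxS this.1))
    -- the points of `B` that see a point outside `B` and no point of `A`
    let P : Set U := {x | x ∈ B ∧ (∀ y, R x y → y ∉ A) ∧ ∃ y, R x y ∧ y ∉ B}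
    have hXB : A ∪ Y ∪ P ⊆ B := by
      rintro x ((hx | hx) | hx)
      · exact hAB hx
      · exact (hYQ hx x (refl_of R x)).1
      · exact hx.1
    refine ⟨A ∪ Y ∪ P, Prod.ext (Set.ext fun x => ?_) (Set.ext fun x => ?_)⟩
    · constructor
      · intro hx y hxy
        exact Or.inl (Or.inl (hA x hx y hxy))
      · intro hx
        rcases hx x (refl_of R x) with (h | h) | h
        · exact h
        · obtain ⟨z, hz, hxz⟩ := (hY x (hYQ h)).2
          rcases hx z hxz with (h' | h') | h'
          · exact ((hYQ h z hxz).2 h').elim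
          · exact (hz h').elim
          · obtain ⟨w, hzw, hw⟩ := h'.2.2
            exact (hw (hYQ h w (_root_.trans hxz hzw)).1).elim
        · obtain ⟨y, hxy, hy⟩ := h.2.2
          exact (hy (hXB (hx y hxy))).elim
    · constructor
      · intro hx
        change x ∈ B at hx
        by_cases h1 : ∃ y, R x y ∧ y ∈ A
        · obtain ⟨y, hxy, hy⟩ := h1
          exact ⟨y, hxy, Or.inl (Or.inl hy)⟩
        · push Not at h1
          by_cases h2 : ∃ y, R x y ∧ y ∉ B
          · exact ⟨x, refl_of R x, Or.inr ⟨hx, h1, h2⟩⟩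
          · push Not at h2
            obtain ⟨y, hy, hxy⟩ := (hY x fun y hxy => ⟨h2 y hxy, h1 y hxy⟩).1
            exact ⟨y, hxy, Or.inl (Or.inr hy)⟩
      · rintro ⟨y, hxy, hy⟩
        exact hB y (hXB hy) x hxy

variable (R)

instance : PartialOrder (IRS R) := inferInstanceAs (PartialOrder (Subtype _))

/-- The lattice `IRS_R(U)`, ordered by componentwise inclusion: joins are componentwise unions and
meets are componentwise intersections. -/
instance : DistribLattice (IRS R) where
  sup p q := ⟨(p.1.1 ∪ q.1.1, p.1.2 ∪ q.1.2), (mem_IRS_iff _).2 (by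
    obtain ⟨h1, h2, h3, h4⟩ := (mem_IRS_iff _).1 p.2
    obtain ⟨k1, k2, k3, k4⟩ := (mem_IRS_iff _).1 q.2
    refine ⟨?_, ?_, Set.union_subset_union h3 k3, fun x hx => Or.imp (h4 x hx) (k4 x hx)⟩
    · exact fun x hx y hxy => hx.imp (fun h => h1 x h y hxy) (fun h => k1 x h y hxy)
    · exact fun x hx y hxy => hx.imp (fun h => h2 x h y hxy) (fun h => k2 x h y hxy))⟩
  inf p q := ⟨(p.1.1 ∩ q.1.1, p.1.2 ∩ q.1.2), (mem_IRS_iff _).2 (by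
    obtain ⟨h1, h2, h3, h4⟩ := (mem_IRS_iff _).1 p.2
    obtain ⟨k1, k2, k3, k4⟩ := (mem_IRS_iff _).1 q.2
    refine ⟨?_, ?_, Set.inter_subset_inter h3 k3, fun x hx => And.imp (h4 x hx) (k4 x hx)⟩
    · exact fun x hx y hxy => hx.imp (fun h => h1 x h y hxy) (fun h => k1 x h y hxy)
    · exact fun x hx y hxy => hx.imp (fun h => h2 x h y hxy) (fun h => k2 x h y hxy))⟩
  le_sup_left p q := ⟨Set.subset_union_left, Set.subset_union_left⟩
  le_sup_right p q := ⟨Set.subset_union_right, Set.subset_union_right⟩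
  sup_le p q r h h' := ⟨Set.union_subset h.1 h'.1, Set.union_subset h.2 h'.2⟩
  inf_le_left p q := ⟨Set.inter_subset_left, Set.inter_subset_left⟩
  inf_le_right p q := ⟨Set.inter_subset_right, Set.inter_subset_right⟩
  le_inf p q r h h' := ⟨Set.subset_inter h.1 h'.1, Set.subset_inter h.2 h'.2⟩
  le_sup_inf p q r := ⟨(Set.union_inter_distrib_left _ _ _).ge,
    (Set.union_inter_distrib_left _ _ _).ge⟩

instance : BoundedOrder (IRS R) where
  top := ⟨(Set.univ, Set.univ), (mem_IRS_iff _).2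
    ⟨fun _ _ _ _ => trivial, fun _ _ _ _ => trivial, subset_rfl, fun _ _ h => h⟩⟩
  bot := ⟨(∅, ∅), (mem_IRS_iff _).2
    ⟨fun _ h _ _ => h.elim, fun _ h _ _ => h.elim, subset_rfl, fun _ _ h => h⟩⟩
  le_top p := ⟨Set.subset_univ _, Set.subset_univ _⟩
  bot_le p := ⟨Set.empty_subset _, Set.empty_subset _⟩

variable {R}

/-- `∼(A, B) = (-B, -A)` -/
def IRS.snot (p : IRS R) : IRS R :=
  ⟨(p.1.2ᶜ, p.1.1ᶜ), (mem_IRS_iff _).2 (by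
    obtain ⟨h1, h2, h3, h4⟩ := (mem_IRS_iff _).1 p.2
    exact ⟨fun x hx y hxy hy => hx (h2 y hy x hxy), fun y hy x hxy hx => hy (h1 x hx y hxy),
      Set.compl_subset_compl.2 h3, fun x hx hx' hx'' => hx' (h4 x hx hx'')⟩)⟩

/-- `(A, B) → (C, D) = ((-A ∪ C)_R, -A ∪ D)` -/
def IRS.wimp (p q : IRS R) : IRS R :=
  ⟨(lower R (p.1.1ᶜ ∪ q.1.1), p.1.1ᶜ ∪ q.1.2), (mem_IRS_iff _).2 (by
    obtain ⟨h1, h2, h3, h4⟩ := (mem_IRS_iff _).1 p.2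
    obtain ⟨k1, k2, k3, k4⟩ := (mem_IRS_iff _).1 q.2
    refine ⟨fun x hx y hxy z hyz => hx z (_root_.trans hxy hyz), ?_, ?_, ?_⟩
    · exact fun y hy x hxy => hy.imp (fun h hx => h (h1 x hx y hxy)) (fun h => k2 y h x hxy)
    · exact fun x hx => (hx x (refl_of R x)).imp id fun h => k3 h
    · intro x hS hx y hxy
      have hy : y ∈ ({x} : Set U) := by rw [← hS]; exact hxy
      rw [Set.mem_singleton_iff] at hy
      rw [hy]
      exact hx.imp id (k4 x hS))⟩

theorem IRS.inf_snot_le (p q : IRS R) : p ⊓ p.snot ≤ q ⊔ q.snot := by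
  obtain ⟨-, -, h3, -⟩ := (mem_IRS_iff _).1 p.2
  obtain ⟨-, -, k3, -⟩ := (mem_IRS_iff _).1 q.2
  exact ⟨fun x hx => (hx.2 (h3 hx.1)).elim, fun x _ =>
    (em (x ∈ q.1.1)).imp (fun h => k3 h) id⟩

theorem IRS.inf_le_iff (p q r : IRS R) : p ⊓ r ≤ p.snot ⊔ q ↔ r ≤ p.wimp q := by
  obtain ⟨h1, h2, h3, h4⟩ := (mem_IRS_iff _).1 p.2
  obtain ⟨k1, k2, k3, k4⟩ := (mem_IRS_iff _).1 r.2
  constructor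
  · rintro ⟨hl, hu⟩
    refine ⟨fun x hx y hxy => ?_, fun x hx => ?_⟩
    · by_cases hy : y ∈ p.1.1
      · exact Or.inr ((hl ⟨hy, k1 x hx y hxy⟩).resolve_left fun h => h (h3 hy))
      · exact Or.inl hy
    · by_cases hy : x ∈ p.1.1
      · exact Or.inr ((hu ⟨h3 hy, hx⟩).resolve_left fun h => h hy)
      · exact Or.inl hy
  · rintro ⟨hl, hu⟩
    refine ⟨fun x hx => ?_, fun x hx => hu hx.2⟩
    exact Or.inr ((hl hx.2 x (refl_of R x)).resolve_left fun h => h hx.1)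

theorem IRS.wimp_inf (p q r : IRS R) : (p ⊓ q).wimp r = p.wimp (q.wimp r) := by
  obtain ⟨h1, -, -, -⟩ := (mem_IRS_iff _).1 p.2
  refine Subtype.ext (Prod.ext (Set.ext fun x => ⟨?_, ?_⟩) ?_)
  · intro hx y hxy
    by_cases hy : y ∈ p.1.1
    · refine Or.inr fun z hyz => ?_
      rcases hx z (_root_.trans hxy hyz) with h | h
      · exact Or.inl fun hz => h ⟨h1 y hy z hyz, hz⟩
      · exact Or.inr h
    · exact Or.inl hy
  · intro hx y hxy
    rcases hx y hxy with h | h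
    · exact Or.inl fun h' => h h'.1
    · rcases h y (refl_of R y) with h | h
      · exact Or.inl fun h' => h h'.2
      · exact Or.inr h
  · change (p.1.1 ∩ q.1.1)ᶜ ∪ r.1.2 = p.1.1ᶜ ∪ (q.1.1ᶜ ∪ r.1.2)
    rw [Set.compl_inter, Set.union_assoc]

variable (R)

/-- The Nelson algebra `IRS_R(U)`, ordered by componentwise inclusion, with the operations
`(A, B) ∨ (C, D) = (A ∪ C, B ∪ D)`, `(A, B) ∧ (C, D) = (A ∩ C, B ∩ D)`, `∼(A, B) = (-B, -A)` and
`(A, B) → (C, D) = ((-A ∪ C)_R, -A ∪ D)`. -/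
instance : NelsonAlgebra (IRS R) where
  snot := IRS.snot
  wimp := IRS.wimp
  snot_snot p := Subtype.ext (Prod.ext (compl_compl _) (compl_compl _))
  le_iff_snot_le_snot p q :=
    ⟨fun h => ⟨Set.compl_subset_compl.2 h.2, Set.compl_subset_compl.2 h.1⟩,
      fun h => ⟨Set.compl_subset_compl.1 h.2, Set.compl_subset_compl.1 h.1⟩⟩
  inf_snot_le_sup_snot := IRS.inf_snot_le
  inf_le_snot_sup_iff := IRS.inf_le_iff
  wimp_inf := IRS.wimp_inf

end Quasiorder

end RoughSet

/-! In the rough set algebra of `R`, every element is a join of the rough sets `leastLower R x` and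
`leastUpper R x`. These are completely join-prime, so the lattice is algebraic and has no other
completely join-irreducibles. The map `g` sends `leastUpper R x` to `leastLower R x`, and the two
coincide when `x` is `R`-closed. Comparing `≅_S` with equality of pseudocomplements shows that
effectiveness means that every `x` sees some closed `s` (`isEffective_iff`). Then `leastUpper R x ≤
leastUpper R s = leastLower R s ≤ leastLower R x`, which is the comparability condition.

Conversely, in an algebraic Nelson algebra the completely join-irreducibles are completely
join-prime and separate points. On them `g` is an order-reversing involution with `j` comparable to
`g(j)`. Take them as points, let `j R k` mean that the larger of `k, g(k)` lies below the larger of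
`j, g(j)`, and send `a` to the pair of sets of those `j` with `j.hi ≤ a` and with `j.lo ≤ a`.
Separation makes this an order embedding. It is onto by primality, the interpolation property
(`exists_interpolant`, the one place where the law `(a ∧ b) → c = a → (b → c)` matters) and the
identification of closed points with fixed points of `g`. Implication is determined by order and
negation, so nothing else has to be preserved. -/

/-! ### Complete join-primality -/

/-- `j` is completely join-prime: if it lies below the join of `X`, it lies below a member of `X`. -/
def IsCompletelyJoinPrime {A : Type u} [PartialOrder A] (j : A) : Prop :=
  ∀ (X : Set A) (a : A), IsLUB X a → j ≤ a → ∃ x ∈ X, j ≤ x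

theorem IsCompletelyJoinPrime.isCompactElement {A : Type u} [PartialOrder A] {j : A}
    (hj : IsCompletelyJoinPrime j) : IsCompactElement j :=
  fun s a _ _ ha hja => hj s a ha hja

theorem IsCompletelyJoinPrime.isCompletelyJoinIrreducible {A : Type u} [PartialOrder A] {j : A}
    (hj : IsCompletelyJoinPrime j) : IsCompletelyJoinIrreducible j := by
  intro X hX
  obtain ⟨x, hx, hjx⟩ := hj X j hX le_rfl
  rwa [le_antisymm hjx (hX.1 hx)]

theorem IsCompletelyJoinPrime.le_sup {A : Type u} [Lattice A] {j a b : A}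
    (hj : IsCompletelyJoinPrime j) (h : j ≤ a ⊔ b) : j ≤ a ∨ j ≤ b := by
  obtain ⟨x, rfl | rfl, hx⟩ := hj {a, b} _ isLUB_pair h
  · exact Or.inl hx
  · exact Or.inr hx

namespace IsAlgebraicLattice

theorem exists_isCompactElement_le {A : Type u} [PartialOrder A] (h : IsAlgebraicLattice A)
    {a b : A} (hab : ¬ a ≤ b) : ∃ c, IsCompactElement c ∧ c ≤ a ∧ ¬ c ≤ b := by
  obtain ⟨s, hs, hsa⟩ := h.2 a
  by_contra! hcon
  exact hab (hsa.2 fun c hc => hcon c (hs c hc) (hsa.1 hc))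

/-- In a distributive algebraic lattice, binary meets distribute over arbitrary joins. -/
theorem isLUB_inf {A : Type u} [DistribLattice A] [OrderBot A] (h : IsAlgebraicLattice A)
    {X : Set A} {a : A} (ha : IsLUB X a) (b : A) : IsLUB ((b ⊓ ·) '' X) (b ⊓ a) := by
  classical
  refine ⟨?_, fun d hd => ?_⟩
  · rintro _ ⟨x, hx, rfl⟩
    exact inf_le_inf_left b (ha.1 hx)
  by_contra hbd
  obtain ⟨c, hc, hcb, hcd⟩ := h.exists_isCompactElement_le hbd
  -- Compactness of `c` is tested on the finite joins from `X`: they form a directed set with join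
  -- `a`, nonempty because of the empty join `⊥`. Finite distributivity then suffices.
  obtain ⟨_, ⟨F, hF, rfl⟩, hcF⟩ := hc {y | ∃ F : Finset A, (∀ x ∈ F, x ∈ X) ∧ F.sup id = y} a
    ⟨⊥, ∅, by simp, rfl⟩ (by
      rintro _ ⟨F, hF, rfl⟩ _ ⟨G, hG, rfl⟩
      exact ⟨_, ⟨F ∪ G, fun x hx => (Finset.mem_union.1 hx).elim (hF x) (hG x), rfl⟩,
        Finset.sup_mono Finset.subset_union_left, Finset.sup_mono Finset.subset_union_right⟩)
    ⟨by
      rintro _ ⟨F, hF, rfl⟩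
      exact Finset.sup_le fun x hx => ha.1 (hF x hx),
     fun y hy => ha.2 fun x hx => hy ⟨{x}, by simpa using hx, by simp⟩⟩ (hcb.trans inf_le_right)
  refine hcd ((le_inf le_rfl hcF).trans ?_)
  rw [Finset.sup_inf_distrib_left]
  exact Finset.sup_le fun x hx =>
    (inf_le_inf_right _ (hcb.trans inf_le_left)).trans (hd ⟨x, hF x hx, rfl⟩)

/-- If `j ≤ ⋁ X`, distributivity gives `j = ⋁ (j ⊓ x)`, so irreducibility yields `j = j ⊓ x` for
some `x ∈ X`. -/
theorem isCompletelyJoinPrime {A : Type u} [DistribLattice A] [OrderBot A]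
    (h : IsAlgebraicLattice A) {j : A} (hj : IsCompletelyJoinIrreducible j) :
    IsCompletelyJoinPrime j := by
  intro X a ha hja
  have := h.isLUB_inf ha j
  rw [inf_eq_left.2 hja] at this
  obtain ⟨x, hx, hjx⟩ := hj _ this
  exact ⟨x, hx, inf_eq_left.1 hjx⟩

/-- In an algebraic lattice, a compact element can be separated from any element not above it by
a maximal such element. -/
theorem exists_maximal_not_ge {A : Type u} [PartialOrder A] (h : IsAlgebraicLattice A)
    {c a : A} (hc : IsCompactElement c) (hca : ¬ c ≤ a) :
    ∃ m, a ≤ m ∧ Maximal (fun x => ¬ c ≤ x) m := by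
  refine zorn_le_nonempty₀ {x | ¬ c ≤ x} (fun s hs hchain y hy => ?_) a hca
  obtain ⟨b, hb⟩ := h.1 s
  refine ⟨b, fun hcb => ?_, fun z hz => hb.1 hz⟩
  obtain ⟨x, hx, hcx⟩ := hc s b ⟨y, hy⟩ hchain.directedOn hb hcb
  exact hs hx hcx

end IsAlgebraicLattice

/-! ### Completely join-irreducible elements of algebraic Nelson algebras -/

namespace NelsonAlgebra

variable {A : Type u} [NelsonAlgebra A]

theorem snot_le_iff {a b : A} : snot a ≤ b ↔ snot b ≤ a := by
  rw [le_iff_snot_le_snot, snot_snot]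

theorem le_snot_iff {a b : A} : a ≤ snot b ↔ b ≤ snot a := by
  rw [le_iff_snot_le_snot, snot_snot]

/-- In an algebraic Nelson algebra the completely join-irreducible elements separate points. -/
theorem exists_isCompletelyJoinIrreducible_le (h : IsAlgebraicLattice A) {a b : A}
    (hab : ¬ a ≤ b) : ∃ j, IsCompletelyJoinIrreducible j ∧ j ≤ a ∧ ¬ j ≤ b := by
  -- Negation turns the problem upside down: an element `m` maximal among those not above a compact
  -- `c` is completely meet-irreducible, so `∼m` is completely join-irreducible.
  rw [le_iff_snot_le_snot] at hab
  obtain ⟨c, hc, hcb, hca⟩ := h.exists_isCompactElement_le hab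
  obtain ⟨m, ham, hcm, hm⟩ := h.exists_maximal_not_ge hc hca
  refine ⟨snot m, fun X hX => ?_, snot_le_iff.1 ham, fun hmb => hcm (hcb.trans (snot_le_iff.1 hmb))⟩
  by_contra hmX
  refine hcm ((le_iff_snot_le_snot c m).2 (hX.2 fun x hx => ?_))
  by_contra hxc
  have := hm (y := snot x) (fun h' => hxc (le_snot_iff.1 h')) (le_snot_iff.1 (hX.1 hx))
  exact hmX (le_antisymm (hX.1 hx) (snot_le_iff.1 this) ▸ hx)

open Classical in
/-- The element `g(j)`: the least `x` with `x ≰ ∼j`, if there is one. -/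
noncomputable def dualIrr (j : A) : A :=
  -- The default `j` is irrelevant: for `j` completely join-irreducible in an algebraic lattice such
  -- an `i` exists.
  if h : ∃ i, ∀ x, i ≤ x ↔ ¬ x ≤ snot j then h.choose else j

/-- By primality, the join `m` of all elements not above `j` is itself not above `j`; its negation
`∼m` is the required least element. -/
theorem dualIrr_le_iff (h : IsAlgebraicLattice A) {j : A} (hj : IsCompletelyJoinIrreducible j)
    (x : A) : dualIrr j ≤ x ↔ ¬ x ≤ snot j := by
  have key : ∃ i, ∀ x, i ≤ x ↔ ¬ x ≤ snot j := by
    obtain ⟨m, hm⟩ := h.1 {x | ¬ j ≤ x}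
    refine ⟨snot m, fun x => ?_⟩
    rw [snot_le_iff, le_snot_iff]
    refine ⟨fun hxm hjx => ?_, fun hx => hm.1 hx⟩
    obtain ⟨y, hy, hjy⟩ := h.isCompletelyJoinPrime hj _ _ hm (hjx.trans hxm)
    exact hy hjy
  rw [dualIrr, dif_pos key]
  exact key.choose_spec x

theorem not_dualIrr_le_iff (h : IsAlgebraicLattice A) {j : A} (hj : IsCompletelyJoinIrreducible j)
    (x : A) : ¬ dualIrr j ≤ x ↔ x ≤ snot j := by
  rw [dualIrr_le_iff h hj, not_not]

theorem isCompletelyJoinIrreducible_dualIrr (h : IsAlgebraicLattice A) {j : A}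
    (hj : IsCompletelyJoinIrreducible j) :
    IsCompletelyJoinIrreducible (dualIrr j) := by
  intro X hX
  have h1 := (dualIrr_le_iff h hj _).1 le_rfl
  obtain ⟨x, hx, hxj⟩ : ∃ x ∈ X, ¬ x ≤ snot j := by
    by_contra! hcon
    exact h1 (hX.2 hcon)
  rwa [le_antisymm ((dualIrr_le_iff h hj x).2 hxj) (hX.1 hx)]

theorem le_iff_not_le_snot_dualIrr (h : IsAlgebraicLattice A) {j : A}
    (hj : IsCompletelyJoinIrreducible j)
    (x : A) : j ≤ x ↔ ¬ x ≤ snot (dualIrr j) := by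
  rw [le_snot_iff, dualIrr_le_iff h hj, not_not, ← le_iff_snot_le_snot]

theorem dualIrr_dualIrr (h : IsAlgebraicLattice A) {j : A} (hj : IsCompletelyJoinIrreducible j) :
    dualIrr (dualIrr j) = j := by
  refine eq_of_forall_ge_iff fun x => ?_
  rw [dualIrr_le_iff h (isCompletelyJoinIrreducible_dualIrr h hj), le_iff_not_le_snot_dualIrr h hj]

theorem isNelsonG_iff (h : IsAlgebraicLattice A) {i j : A} (hj : IsCompletelyJoinIrreducible j) :
    IsNelsonG j i ↔ dualIrr j = i := by
  have : IsGLB {x : A | ¬ x ≤ snot j} (dualIrr j) :=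
    ⟨fun x hx => (dualIrr_le_iff h hj x).2 hx, fun b hb => hb ((dualIrr_le_iff h hj _).1 le_rfl)⟩
  exact ⟨fun hi => this.unique hi, fun hi => hi ▸ this⟩

/-- This is the Kleene law: if `g(j) ≰ j`, then `j ≤ ∼j`, so `j ≤ g(j) ∨ ∼g(j)`. Primality leaves `j
≤ g(j)`, since `j ≤ ∼g(j)` would give `g(j) ≤ ∼j`. -/
theorem dualIrr_le_or_le (h : IsAlgebraicLattice A) {j : A} (hj : IsCompletelyJoinIrreducible j) :
    dualIrr j ≤ j ∨ j ≤ dualIrr j := by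
  rw [or_iff_not_imp_left, not_dualIrr_le_iff h hj]
  intro hjj
  rcases (h.isCompletelyJoinPrime hj).le_sup
    ((le_inf le_rfl hjj).trans (inf_snot_le_sup_snot j (dualIrr j))) with h' | h'
  · exact h'
  · exact absurd (le_snot_iff.1 h') ((dualIrr_le_iff h hj _).1 le_rfl)

theorem dualIrr_le_comm (h : IsAlgebraicLattice A) {j k : A} (hj : IsCompletelyJoinIrreducible j)
    (hk : IsCompletelyJoinIrreducible k) :
    dualIrr j ≤ k ↔ dualIrr k ≤ j := by
  rw [dualIrr_le_iff h hj, dualIrr_le_iff h hk, le_snot_iff]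

theorem dualIrr_le_dualIrr_iff (h : IsAlgebraicLattice A) {j k : A}
    (hj : IsCompletelyJoinIrreducible j)
    (hk : IsCompletelyJoinIrreducible k) :
    dualIrr j ≤ dualIrr k ↔ k ≤ j := by
  rw [dualIrr_le_comm h hj (isCompletelyJoinIrreducible_dualIrr h hk), dualIrr_dualIrr h hk]

/-- The interpolation property of algebraic Nelson algebras. -/
theorem exists_interpolant (h : IsAlgebraicLattice A) {j k : A}
    (hj : IsCompletelyJoinIrreducible j)
    (hk : IsCompletelyJoinIrreducible k)
    (hj' : dualIrr j ≤ j) (hk' : dualIrr k ≤ k) (hjk : dualIrr j ≤ k) :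
    ∃ i, IsCompletelyJoinIrreducible i ∧ i ≤ j ∧ dualIrr i ≤ j ∧ i ≤ k ∧ dualIrr i ≤ k := by
  by_contra! hcon
  -- An irreducible `i` violating this inequality would be an interpolant. The redundant `j` and `⊥`
  -- give it the shape of the residuation law, which turns it into `j ≤ (j ∧ k) → ⊥ = j → (k → ⊥)`.
  have h1 : (j ⊓ k) ⊓ j ≤ snot (j ⊓ k) ⊔ ⊥ := by
    by_contra hle
    obtain ⟨i, hi, hi1, hi2⟩ := exists_isCompletelyJoinIrreducible_le h hle
    have hij := inf_le_left.trans' (hi1.trans inf_le_left)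
    have hik := inf_le_right.trans' (hi1.trans inf_le_left)
    rw [sup_bot_eq, le_snot_iff, ← dualIrr_le_iff h hi, le_inf_iff] at hi2
    exact hcon i hi hij hi2.1 hik hi2.2
  rw [inf_le_snot_sup_iff, wimp_inf, ← inf_le_snot_sup_iff, inf_idem] at h1
  -- As `g(j) ≤ j` means `j ≰ ∼j`, primality gives `j ≤ k → ⊥`, that is `k ∧ j ≤ ∼k`. But `g(k)`
  -- lies below `k` and `j`, and never below `∼k`.
  have h2 := ((h.isCompletelyJoinPrime hj).le_sup h1).resolve_left ((dualIrr_le_iff h hj j).1 hj')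
  rw [← inf_le_snot_sup_iff, sup_bot_eq] at h2
  have h3 := (le_inf hk' ((dualIrr_le_comm h hj hk).1 hjk)).trans h2
  exact (dualIrr_le_iff h hk _).1 le_rfl h3

end NelsonAlgebra

/-! ### Order isomorphisms of Nelson algebras -/

namespace NelsonAlgebra

variable {A : Type u} {B : Type v} [NelsonAlgebra A] [NelsonAlgebra B]

/-- An order isomorphism that preserves strong negation is an isomorphism of Nelson algebras. -/
def _root_.NelsonEquiv.ofOrderIso (e : A ≃o B) (he : ∀ a, e (snot a) = snot (e a)) :
    NelsonEquiv A B where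
  toEquiv := e.toEquiv
  map_sup := e.map_sup
  map_inf := e.map_inf
  map_snot := he
  map_bot := e.map_bot
  map_top := e.map_top
  map_wimp a b := by
    -- Residuation characterizes `a → b` through lattice operations and negation alone.
    refine eq_of_forall_le_iff fun c => ?_
    obtain ⟨c, rfl⟩ := e.surjective c
    change e c ≤ e (wimp a b) ↔ e c ≤ wimp (e a) (e b)
    rw [e.le_iff_le, ← inf_le_snot_sup_iff, ← inf_le_snot_sup_iff, ← he, ← e.map_inf, ← e.map_sup,
      e.le_iff_le]

/-- The order isomorphism underlying an isomorphism of Nelson algebras. -/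
def _root_.NelsonEquiv.toOrderIso (e : NelsonEquiv A B) : A ≃o B where
  toEquiv := e.toEquiv
  map_rel_iff' {a b} := by
    rw [← inf_eq_left, ← inf_eq_left]
    exact (iff_of_eq (congrArg (· = e.toFun a) (e.map_inf a b).symm)).trans e.toEquiv.apply_eq_iff_eq

end NelsonAlgebra

/-! ### Effective rough set lattices -/

namespace RoughSet

theorem mem_closedPoints_iff {U : Type u} {R : U → U → Prop} [IsPreorder U R] {x : U} :
    x ∈ closedPoints R ↔ ∀ y, R x y → y = x := by
  refine ⟨fun h y hxy => ?_, fun h => Set.ext fun y => ⟨h y, ?_⟩⟩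
  · have : y ∈ {y | R x y} := hxy
    rwa [h] at this
  · rintro rfl
    exact refl_of R y

section Glivenko

variable {H : Type u} [HeytingAlgebra H]

/-- Let `c` complement `a` modulo `η`. Then `(a ⊓ c)ᶜ` is congruent to `⊤`, so `c` is congruent to
`c ⊓ (a ⊓ c)ᶜ ≤ aᶜ`; hence `aᶜ` also joins with `a` to the top. -/
theorem _root_.IsBooleanCongruence.sup_compl {η : H → H → Prop} (hη : IsBooleanCongruence η)
    (a : H) : η (a ⊔ aᶜ) ⊤ := by
  have refl := hη.equivalence.refl
  obtain ⟨c, hac, hac'⟩ := hη.complemented a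
  have h1 : η ((a ⊓ c)ᶜ) ⊤ := by simpa using hη.himp _ _ _ _ hac (refl ⊥)
  have h2 : η (c ⊓ (a ⊓ c)ᶜ) c := by simpa using hη.inf _ _ _ _ (refl c) h1
  have h3 : c ⊓ (a ⊓ c)ᶜ ≤ aᶜ := by
    rw [le_compl_iff_disjoint_left, disjoint_iff_inf_le]
    calc a ⊓ (c ⊓ (a ⊓ c)ᶜ) = (a ⊓ c) ⊓ (a ⊓ c)ᶜ := by rw [inf_assoc]
      _ ≤ ⊥ := by simp
  have h4 := hη.equivalence.trans (hη.sup _ _ _ _ (refl a) h2) hac'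
  have h5 := hη.sup _ _ _ _ h4 (refl aᶜ)
  rwa [sup_assoc, sup_eq_right.2 h3, top_sup_eq] at h5

/-- A Boolean congruence identifies elements with equal pseudocomplements. -/
theorem _root_.IsBooleanCongruence.of_compl_eq {η : H → H → Prop} (hη : IsBooleanCongruence η)
    {a b : H} (hab : aᶜ = bᶜ) : η a b := by
  -- Modulo `η`, `a` equals `a ⊓ (b ⊔ bᶜ) = (a ⊓ b) ⊔ (a ⊓ aᶜ) = a ⊓ b`.
  have key : ∀ {a b : H}, aᶜ = bᶜ → η (a ⊓ b) a := fun {a b} hab => by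
    have := hη.inf _ _ _ _ (hη.equivalence.refl a) (hη.sup_compl b)
    rwa [inf_sup_left, ← hab, inf_compl_self, sup_bot_eq, inf_top_eq] at this
  exact hη.equivalence.trans (hη.equivalence.symm (key hab)) (inf_comm a b ▸ key hab.symm)

/-- Having equal pseudocomplements is a Boolean congruence. -/
theorem _root_.isBooleanCongruence_compl_eq : IsBooleanCongruence fun a b : H => aᶜ = bᶜ where
  equivalence := ⟨fun _ => rfl, Eq.symm, Eq.trans⟩
  sup a b c d h h' := by simp only [compl_sup, h, h']
  inf a b c d h h' := by
    rw [← compl_compl_compl (a ⊓ c), ← compl_compl_compl (b ⊓ d), compl_compl_inf_distrib,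
      compl_compl_inf_distrib, h, h']
  himp a b c d h h' := by
    rw [← compl_compl_compl (a ⇨ c), ← compl_compl_compl (b ⇨ d), compl_compl_himp_distrib,
      compl_compl_himp_distrib, h, h']
  complemented a := ⟨aᶜ, by simp, by simp⟩

end Glivenko

variable {U : Type u} (R : U → U → Prop) [IsPreorder U R]

/-- At a closed point `s` an implication is evaluated classically, because `s` sees only itself. So
taking traces on `S` is a homomorphism into the Boolean algebra of subsets of `S`. -/
theorem isBooleanCongruence_congS : IsBooleanCongruence (congS R) := by
  have hcong : ∀ X Y : Opens R, congS R X Y ↔ ∀ s ∈ closedPoints R, s ∈ X.1 ↔ s ∈ Y.1 := by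
    intro X Y
    rw [congS, Set.ext_iff]
    simp only [Set.mem_inter_iff, and_congr_left_iff]
  have hhimp : ∀ X Y : Opens R, ∀ s ∈ closedPoints R, s ∈ (X ⇨ Y).1 ↔ (s ∈ X.1 → s ∈ Y.1) := by
    intro X Y s hs
    have hs := mem_closedPoints_iff.1 hs
    refine ⟨fun h hX => (h s (refl_of R s)).resolve_left (fun h => h hX), fun h y hy => ?_⟩
    rw [hs y hy]
    exact (em (s ∈ X.1)).symm.imp id h
  refine ⟨⟨⟨fun _ => rfl, Eq.symm, Eq.trans⟩, ?_, ?_, ?_⟩, ?_⟩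
  · intro a b c d h h'
    rw [hcong] at *
    exact fun s hs => or_congr (h s hs) (h' s hs)
  · intro a b c d h h'
    rw [hcong] at *
    exact fun s hs => and_congr (h s hs) (h' s hs)
  · intro a b c d h h'
    rw [hcong] at *
    intro s hs
    rw [hhimp _ _ s hs, hhimp _ _ s hs, h s hs, h' s hs]
  · intro a
    refine ⟨a ⇨ ⊥, ?_, ?_⟩
    · simp only [himp_bot, inf_compl_self]
      rfl
    · rw [hcong]
      refine fun s hs => ⟨fun _ => trivial, fun _ => ?_⟩
      by_cases h : s ∈ a.1
      · exact Or.inl h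
      · exact Or.inr ((hhimp _ _ s hs).2 fun h' => (h h').elim)

/-- `IRS_R(U)` is effective iff each point is below an `R`-closed point. -/
theorem isEffective_iff : IsEffective R ↔ ∀ x, ∃ s ∈ closedPoints R, R x s := by
  constructor
  · intro h x
    by_contra! hcon
    -- If `R(x)` misses `S`, it is `≅_S`-related to `∅`. Minimality of `≅_S` then gives both the
    -- same pseudocomplement, which forces `R(x) = ∅`.
    let X : Opens R := ⟨{y | R x y}, (isOpen_iff R _).2 fun y hy z hz => _root_.trans hy hz⟩
    have hX : congS R X ⊥ := by
      change {y | R x y} ∩ closedPoints R = ∅ ∩ closedPoints R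
      rw [Set.empty_inter, Set.eq_empty_iff_forall_notMem]
      exact fun s hs => hcon s hs.2 hs.1
    have h1 : Xᶜ = ⊥ᶜ := h.2 _ isBooleanCongruence_compl_eq _ _ hX
    have h2 : X ≤ Xᶜᶜ := le_compl_compl
    rw [h1, compl_bot, compl_top] at h2
    exact h2 (refl_of R x)
  · refine fun h => ⟨isBooleanCongruence_congS R, fun η hη a b hab => hη.of_compl_eq ?_⟩
    have key : ∀ {a b : Opens R}, congS R a b → aᶜ ≤ bᶜ := by
      intro a b hab x hx y hxy hy
      obtain ⟨s, hs, hys⟩ := h y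
      have hsb : s ∈ b.1 ∩ closedPoints R := ⟨(isOpen_iff R _).1 b.2 y hy s hys, hs⟩
      rw [← hab] at hsb
      exact hx s (_root_.trans hxy hys) hsb.1
    exact le_antisymm (key hab) (key hab.symm)

end RoughSet

/-! ### The rough set representation of algebraic Nelson algebras -/

namespace NelsonAlgebra

variable (A : Type u) [NelsonAlgebra A]

/-- The completely join-irreducible elements of `A`. -/
def Irr : Type u := {j : A // IsCompletelyJoinIrreducible j}

variable {A}

/-- The larger one of `j` and `g(j)`. -/
noncomputable def Irr.hi (j : Irr A) : A := j.1 ⊔ dualIrr j.1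

/-- The smaller one of `j` and `g(j)`. -/
noncomputable def Irr.lo (j : Irr A) : A := j.1 ⊓ dualIrr j.1

/-- The quasiorder on the completely join-irreducible elements that represents `A`. -/
def Irr.rel (j k : Irr A) : Prop := k.hi ≤ j.hi

instance : IsPreorder (Irr A) Irr.rel where
  refl _ := le_rfl
  trans _ _ _ h h' := h'.trans h

theorem Irr.lo_le_hi (j : Irr A) : j.lo ≤ j.hi := inf_le_left.trans le_sup_left

theorem Irr.hi_lo_eq (h : IsAlgebraicLattice A) (j : Irr A) :
    (j.hi = j.1 ∧ j.lo = dualIrr j.1) ∨ (j.hi = dualIrr j.1 ∧ j.lo = j.1) := by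
  rcases dualIrr_le_or_le h j.2 with hj | hj
  · exact Or.inl ⟨sup_eq_left.2 hj, inf_eq_right.2 hj⟩
  · exact Or.inr ⟨sup_eq_right.2 hj, inf_eq_left.2 hj⟩

theorem Irr.isCompletelyJoinIrreducible_hi (h : IsAlgebraicLattice A)
    (j : Irr A) : IsCompletelyJoinIrreducible j.hi := by
  rcases j.hi_lo_eq h with ⟨hj, -⟩ | ⟨hj, -⟩ <;> rw [hj]
  · exact j.2
  · exact isCompletelyJoinIrreducible_dualIrr h j.2

theorem Irr.dualIrr_hi (h : IsAlgebraicLattice A) (j : Irr A) : dualIrr j.hi = j.lo := by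
  rcases j.hi_lo_eq h with ⟨hj, hj'⟩ | ⟨hj, hj'⟩ <;> rw [hj, hj']
  exact dualIrr_dualIrr h j.2

theorem Irr.isCompletelyJoinIrreducible_lo (h : IsAlgebraicLattice A)
    (j : Irr A) : IsCompletelyJoinIrreducible j.lo :=
  j.dualIrr_hi h ▸ isCompletelyJoinIrreducible_dualIrr h (j.isCompletelyJoinIrreducible_hi h)

theorem Irr.lo_le_lo_iff (h : IsAlgebraicLattice A) (j k : Irr A) : j.lo ≤ k.lo ↔ k.hi ≤ j.hi := by
  rw [← j.dualIrr_hi h, ← k.dualIrr_hi h, dualIrr_le_dualIrr_iff h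
    (j.isCompletelyJoinIrreducible_hi h) (k.isCompletelyJoinIrreducible_hi h)]

theorem Irr.hi_le_iff (h : IsAlgebraicLattice A)
    (j : Irr A) (a : A) : j.hi ≤ a ↔ ¬ j.lo ≤ snot a := by
  rw [← j.dualIrr_hi h, dualIrr_le_iff h (j.isCompletelyJoinIrreducible_hi h), not_not,
    ← le_iff_snot_le_snot]

theorem Irr.lo_le_iff (h : IsAlgebraicLattice A)
    (j : Irr A) (a : A) : j.lo ≤ a ↔ ¬ j.hi ≤ snot a := by
  rw [j.hi_le_iff h, snot_snot, not_not]

/-- The fixed points of `g` are `R`-closed. -/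
theorem Irr.mem_closedPoints (h : IsAlgebraicLattice A) (s : Irr A) (hs : s.hi ≤ s.lo) :
    s ∈ RoughSet.closedPoints (Irr.rel (A := A)) := by
  refine RoughSet.mem_closedPoints_iff.2 fun y (hy : y.hi ≤ s.hi) => ?_
  -- Everything collapses in `s.lo ≤ y.lo ≤ y.hi ≤ s.hi`.
  have h1 : s.lo = s.hi := le_antisymm s.lo_le_hi hs
  have h2 : s.lo ≤ y.lo := (Irr.lo_le_lo_iff h s y).2 hy
  have h3 : y.hi = s.hi := le_antisymm hy (h1 ▸ h2.trans y.lo_le_hi)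
  have h4 : y.lo = s.hi := le_antisymm (y.lo_le_hi.trans hy) (h1 ▸ h2)
  have hy' : y.1 = s.hi := le_antisymm (le_sup_left.trans h3.le) (h4.ge.trans inf_le_left)
  have hs' : s.1 = s.hi := le_antisymm le_sup_left (h1.ge.trans inf_le_left)
  exact Subtype.ext (hy'.trans hs'.symm)

/-- The `R`-closed points are fixed points of `g`. -/
theorem Irr.hi_eq_lo_of_mem_closedPoints (h : IsAlgebraicLattice A) (s : Irr A)
    (hs : s ∈ RoughSet.closedPoints (Irr.rel (A := A))) : s.hi = s.lo := by
  -- The point `g(s)` has the same `hi` as `s`, so `s` sees it; closedness forces `g(s) = s`.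
  let t : Irr A := ⟨dualIrr s.1, isCompletelyJoinIrreducible_dualIrr h s.2⟩
  have ht : t.hi = s.hi := by
    change dualIrr s.1 ⊔ dualIrr (dualIrr s.1) = s.1 ⊔ dualIrr s.1
    rw [dualIrr_dualIrr h s.2, sup_comm]
  have hts : dualIrr s.1 = s.1 :=
    congrArg Subtype.val (RoughSet.mem_closedPoints_iff.1 hs t ht.le)
  rw [Irr.hi, Irr.lo, hts, sup_idem, inf_idem]

/-- The representation of an element of `A` as a pair of sets of completely join-irreducible
elements. -/
noncomputable def toIRS (h : IsAlgebraicLattice A) (a : A) : RoughSet.IRS (Irr.rel (A := A)) :=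
  ⟨({j | j.hi ≤ a}, {j | j.lo ≤ a}), (RoughSet.mem_IRS_iff _).2
    ⟨fun _ hx _ hxy => hxy.trans hx, fun y hy x hxy => ((x.lo_le_lo_iff h y).2 hxy).trans hy,
      fun x hx => x.lo_le_hi.trans hx,
      fun x hx (hxa : x.lo ≤ a) => (x.hi_eq_lo_of_mem_closedPoints h hx).trans_le hxa⟩⟩

theorem toIRS_le_toIRS_iff (h : IsAlgebraicLattice A)
    {a b : A} : toIRS h a ≤ toIRS h b ↔ a ≤ b := by
  refine ⟨fun hab => ?_, fun hab => ⟨fun x hx => le_trans hx hab, fun x hx => le_trans hx hab⟩⟩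
  by_contra hcon
  obtain ⟨j, hj, hja, hjb⟩ := exists_isCompletelyJoinIrreducible_le h hcon
  obtain ⟨j, rfl⟩ : ∃ j' : Irr A, j'.1 = j := ⟨⟨j, hj⟩, rfl⟩
  rcases j.hi_lo_eq h with ⟨h1, -⟩ | ⟨-, h1⟩ <;> rw [← h1] at hja hjb
  · exact hjb (hab.1 hja)
  · exact hjb (hab.2 hja)

theorem toIRS_surjective (h : IsAlgebraicLattice A) : Function.Surjective (toIRS h) := by
  rintro ⟨⟨C, D⟩, hCD⟩
  obtain ⟨hC, hD, hsub, hS⟩ := (RoughSet.mem_IRS_iff _).1 hCD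
  dsimp only at hC hD hsub hS
  obtain ⟨a, ha⟩ := h.1 (Irr.hi '' C ∪ Irr.lo '' D)
  refine ⟨a, Subtype.ext (Prod.ext (Set.ext fun j => ⟨fun hj => ?_, fun hj => ?_⟩)
    (Set.ext fun j => ⟨fun hj => ?_, fun hj => ?_⟩))⟩
  · obtain ⟨_, ⟨x, hx, rfl⟩ | ⟨y, hy, rfl⟩, hle⟩ :=
      h.isCompletelyJoinPrime (j.isCompletelyJoinIrreducible_hi h) _ _ ha hj
    · exact hC x hx j hle
    -- Here `j.hi ≤ y.lo` makes `y` a fixed point of `g`, hence closed, so `y ∈ D` already gives `y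
    -- ∈ C`.
    · have hyj : y.hi ≤ j.hi := (j.lo_le_lo_iff h y).1 (j.lo_le_hi.trans hle)
      exact hC y (hS y (y.mem_closedPoints h (hyj.trans hle)) hy) j (hle.trans y.lo_le_hi)
  · exact ha.1 (Or.inl ⟨j, hj, rfl⟩)
  · obtain ⟨_, ⟨x, hx, rfl⟩ | ⟨y, hy, rfl⟩, hle⟩ :=
      h.isCompletelyJoinPrime (j.isCompletelyJoinIrreducible_lo h) _ _ ha hj
    -- From `j.lo ≤ x.hi` interpolation yields a point `i` seen by both `j` and `x`. It is in `C ⊆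
    -- D` because `x ∈ C`, and then `j ∈ D`.
    · obtain ⟨i, hi, hij, hij', hix, hix'⟩ := exists_interpolant h
        (j.isCompletelyJoinIrreducible_hi h) (x.isCompletelyJoinIrreducible_hi h)
        (j.dualIrr_hi h ▸ j.lo_le_hi) (x.dualIrr_hi h ▸ x.lo_le_hi) (j.dualIrr_hi h ▸ hle)
      exact hD ⟨i, hi⟩ (hsub (hC x hx _ (sup_le hix hix'))) j (sup_le hij hij')
    · exact hD y hy j ((j.lo_le_lo_iff h y).1 hle)
  · exact ha.1 (Or.inr ⟨j, hj, rfl⟩)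

theorem toIRS_snot (h : IsAlgebraicLattice A) (a : A) : toIRS h (snot a) = snot (toIRS h a) := by
  refine Subtype.ext (Prod.ext (Set.ext fun j => ?_) (Set.ext fun j => ?_))
  · change j.hi ≤ snot a ↔ ¬ j.lo ≤ a
    rw [j.lo_le_iff h, not_not]
  · change j.lo ≤ snot a ↔ ¬ j.hi ≤ a
    rw [j.hi_le_iff h, not_not]

/-- An algebraic Nelson algebra is isomorphic to the rough set algebra of its completely
join-irreducible elements. -/
noncomputable def equivIRS (h : IsAlgebraicLattice A) :
    NelsonEquiv A (RoughSet.IRS (Irr.rel (A := A))) :=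
  NelsonEquiv.ofOrderIso
    (RelIso.ofSurjective (OrderEmbedding.ofMapLEIff (toIRS h) fun _ _ => toIRS_le_toIRS_iff h)
      (toIRS_surjective h)) (toIRS_snot h)

theorem isEffective_rel (h : IsAlgebraicLattice A)
    (hg : ∀ j : A, IsCompletelyJoinIrreducible j →
      ∃ k : A, IsCompletelyJoinIrreducible k ∧ IsNelsonG k k ∧ (j ≤ k ∨ k ≤ j)) :
    RoughSet.IsEffective (Irr.rel (A := A)) := by
  refine (RoughSet.isEffective_iff _).2 fun x => ?_
  obtain ⟨k, hk, hkk, hxk⟩ := hg x.hi (x.isCompletelyJoinIrreducible_hi h)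
  rw [isNelsonG_iff h hk] at hkk
  have hhi : Irr.hi ⟨k, hk⟩ = k := by
    change k ⊔ dualIrr k = k
    rw [hkk, sup_idem]
  have hlo : Irr.lo ⟨k, hk⟩ = k := by
    change k ⊓ dualIrr k = k
    rw [hkk, inf_idem]
  refine ⟨⟨k, hk⟩, Irr.mem_closedPoints h _ (by rw [hhi, hlo]), ?_⟩
  change Irr.hi _ ≤ _
  rw [hhi]
  rcases hxk with hxk | hxk
  -- Order reversal turns `x.hi ≤ k` into `k ≤ x.lo`, so in both cases `x` sees `k`.
  · have := (Irr.lo_le_lo_iff h ⟨k, hk⟩ x).2 (by rwa [hhi])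
    rw [hlo] at this
    exact this.trans x.lo_le_hi
  · exact hxk

end NelsonAlgebra

/-! ### Completely join-irreducible rough sets -/

namespace RoughSet.IRS

variable {U : Type u} {R : U → U → Prop} [IsPreorder U R]

/-- The componentwise union of a set of rough sets. -/
def sUnion (s : Set (IRS R)) : IRS R :=
  ⟨(⋃ p ∈ s, p.1.1, ⋃ p ∈ s, p.1.2), (mem_IRS_iff _).2 (by
    simp only [Set.mem_iUnion]
    refine ⟨?_, ?_, Set.iUnion₂_mono fun p _ => ((mem_IRS_iff _).1 p.2).2.2.1, ?_⟩
    · rintro x ⟨p, hp, hx⟩ y hxy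
      exact ⟨p, hp, ((mem_IRS_iff _).1 p.2).1 x hx y hxy⟩
    · rintro y ⟨p, hp, hy⟩ x hxy
      exact ⟨p, hp, ((mem_IRS_iff _).1 p.2).2.1 y hy x hxy⟩
    · rintro x hx ⟨p, hp, hxp⟩
      exact ⟨p, hp, ((mem_IRS_iff _).1 p.2).2.2.2 x hx hxp⟩)⟩

theorem isLUB_sUnion (s : Set (IRS R)) : IsLUB s (sUnion s) :=
  ⟨fun _ hp => ⟨Set.subset_biUnion_of_mem (u := fun p : IRS R => p.1.1) hp,
    Set.subset_biUnion_of_mem (u := fun p : IRS R => p.1.2) hp⟩,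
   fun _ hq => ⟨Set.iUnion₂_subset fun _ hp => (hq hp).1, Set.iUnion₂_subset fun _ hp => (hq hp).2⟩⟩

variable (R)

/-- The least rough set that contains `x` in its lower approximation. -/
def leastLower (x : U) : IRS R :=
  ⟨({y | R x y}, {y | ∃ z, R x z ∧ R y z}), (mem_IRS_iff _).2 (by
    refine ⟨fun y hxy z hyz => _root_.trans hxy hyz, ?_, fun y hxy => ⟨y, hxy, refl_of R y⟩, ?_⟩
    · rintro y ⟨w, hxw, hyw⟩ z hzy
      exact ⟨w, hxw, _root_.trans hzy hyw⟩
    · rintro y hy ⟨z, hxz, hyz⟩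
      rw [mem_closedPoints_iff.1 hy z hyz] at hxz
      exact hxz)⟩

/-- The least rough set that contains `x` in its upper approximation. -/
def leastUpper (x : U) : IRS R :=
  -- A closed point of the upper approximation must belong to the lower one, and `x` is the only
  -- closed point that can see `x`.
  ⟨({y | y = x ∧ x ∈ closedPoints R}, {y | R y x}), (mem_IRS_iff _).2 (by
    refine ⟨?_, fun y hyx z hzy => _root_.trans hzy hyx, ?_, ?_⟩
    · rintro y ⟨rfl, hy⟩ z hyz
      exact ⟨mem_closedPoints_iff.1 hy z hyz, hy⟩
    · rintro y ⟨rfl, -⟩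
      exact refl_of R y
    · intro y hy hyx
      obtain rfl := mem_closedPoints_iff.1 hy x hyx
      exact ⟨rfl, hy⟩)⟩

variable {R}

theorem leastLower_le_iff {x : U} {p : IRS R} : leastLower R x ≤ p ↔ x ∈ p.1.1 := by
  obtain ⟨h1, h2, h3, -⟩ := (mem_IRS_iff _).1 p.2
  refine ⟨fun h => h.1 (refl_of R x), fun h => ⟨fun y hxy => h1 x h y hxy, ?_⟩⟩
  rintro y ⟨z, hxz, hyz⟩
  exact h2 z (h3 (h1 x h z hxz)) y hyz

theorem leastUpper_le_iff {x : U} {p : IRS R} : leastUpper R x ≤ p ↔ x ∈ p.1.2 := by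
  obtain ⟨-, h2, -, h4⟩ := (mem_IRS_iff _).1 p.2
  refine ⟨fun h => h.2 (refl_of R x), fun h => ⟨?_, fun y hyx => h2 x h y hyx⟩⟩
  rintro y ⟨rfl, hy⟩
  exact h4 y hy h

theorem isCompletelyJoinPrime_leastLower (x : U) : IsCompletelyJoinPrime (leastLower R x) := by
  intro X a ha hxa
  rw [ha.unique (isLUB_sUnion X), leastLower_le_iff] at hxa
  obtain ⟨p, hp, hx⟩ := Set.mem_iUnion₂.1 hxa
  exact ⟨p, hp, leastLower_le_iff.2 hx⟩

theorem isCompletelyJoinPrime_leastUpper (x : U) : IsCompletelyJoinPrime (leastUpper R x) := by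
  intro X a ha hxa
  rw [ha.unique (isLUB_sUnion X), leastUpper_le_iff] at hxa
  obtain ⟨p, hp, hx⟩ := Set.mem_iUnion₂.1 hxa
  exact ⟨p, hp, leastUpper_le_iff.2 hx⟩

theorem isLUB_least (p : IRS R) : IsLUB (leastLower R '' p.1.1 ∪ leastUpper R '' p.1.2) p := by
  refine ⟨?_, fun q hq => ⟨fun x hx => leastLower_le_iff.1 (hq (Or.inl ⟨x, hx, rfl⟩)),
    fun x hx => leastUpper_le_iff.1 (hq (Or.inr ⟨x, hx, rfl⟩))⟩⟩
  rintro _ (⟨x, hx, rfl⟩ | ⟨x, hx, rfl⟩)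
  · exact leastLower_le_iff.2 hx
  · exact leastUpper_le_iff.2 hx

variable (R) in
theorem isAlgebraicLattice : IsAlgebraicLattice (IRS R) := by
  refine ⟨fun s => ⟨_, isLUB_sUnion s⟩, fun p => ⟨_, ?_, isLUB_least p⟩⟩
  rintro _ (⟨x, -, rfl⟩ | ⟨x, -, rfl⟩)
  · exact (isCompletelyJoinPrime_leastLower x).isCompactElement
  · exact (isCompletelyJoinPrime_leastUpper x).isCompactElement

theorem eq_least_of_isCompletelyJoinIrreducible {p : IRS R} (hp : IsCompletelyJoinIrreducible p) :
    ∃ x, p = leastLower R x ∨ p = leastUpper R x := by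
  rcases hp _ (isLUB_least p) with ⟨x, -, hx⟩ | ⟨x, -, hx⟩
  · exact ⟨x, Or.inl hx.symm⟩
  · exact ⟨x, Or.inr hx.symm⟩

theorem leastLower_eq_leastUpper {s : U} (hs : s ∈ closedPoints R) :
    leastLower R s = leastUpper R s := by
  refine eq_of_forall_ge_iff fun p => ?_
  obtain ⟨-, -, h3, h4⟩ := (mem_IRS_iff _).1 p.2
  rw [leastLower_le_iff, leastUpper_le_iff]
  exact ⟨fun h => h3 h, h4 s hs⟩

theorem le_snot_leastUpper_iff {x : U} {p : IRS R} :
    p ≤ NelsonAlgebra.snot (leastUpper R x) ↔ x ∉ p.1.1 := by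
  rw [NelsonAlgebra.le_snot_iff, leastUpper_le_iff]
  rfl

/-- The rough sets not below `∼(leastUpper R x)` are those with `x` in the lower approximation, a
principal filter. -/
theorem isNelsonG_leastUpper (x : U) : IsNelsonG (leastUpper R x) (leastLower R x) := by
  have : {p : IRS R | ¬ p ≤ NelsonAlgebra.snot (leastUpper R x)} = Set.Ici (leastLower R x) := by
    ext p
    rw [Set.mem_ofPred_eq, le_snot_leastUpper_iff, not_not, Set.mem_Ici, leastLower_le_iff]
  rw [IsNelsonG, this]
  exact isGLB_Ici

theorem exists_comparable_of_isEffective (h : IsEffective R) {p : IRS R}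
    (hp : IsCompletelyJoinIrreducible p) :
    ∃ k : IRS R, IsCompletelyJoinIrreducible k ∧ IsNelsonG k k ∧ (p ≤ k ∨ k ≤ p) := by
  obtain ⟨x, hx⟩ := eq_least_of_isCompletelyJoinIrreducible hp
  obtain ⟨s, hs, hxs⟩ := (isEffective_iff R).1 h x
  have hg := isNelsonG_leastUpper (R := R) s
  rw [leastLower_eq_leastUpper hs] at hg
  refine ⟨_, (isCompletelyJoinPrime_leastUpper s).isCompletelyJoinIrreducible, hg, ?_⟩
  rcases hx with rfl | rfl
  · exact Or.inr (leastLower_eq_leastUpper hs ▸ leastLower_le_iff.2 hxs)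
  · exact Or.inl (leastUpper_le_iff.2 hxs)

end RoughSet.IRS

/-! ### Transport along isomorphisms -/

namespace OrderIso

variable {A : Type u} {B : Type v} [PartialOrder A] [PartialOrder B]

theorem isCompactElement_apply (e : A ≃o B) {c : A} (hc : IsCompactElement c) :
    IsCompactElement (e c) := by
  intro s b hs hdir hb hcb
  obtain ⟨x, hx, hcx⟩ := hc (e ⁻¹' s) (e.symm b) (hs.preimage e.surjective)
    (fun x hx y hy => by
      obtain ⟨z, hz, hxz, hyz⟩ := hdir _ hx _ hy
      exact ⟨e.symm z, by simpa using hz, e.le_symm_apply.2 hxz, e.le_symm_apply.2 hyz⟩)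
    (e.isLUB_preimage'.2 hb) (e.le_symm_apply.2 hcb)
  exact ⟨e x, hx, e.le_iff_le.2 hcx⟩

theorem isAlgebraicLattice (e : A ≃o B) (h : IsAlgebraicLattice A) : IsAlgebraicLattice B := by
  refine ⟨fun s => ?_, fun b => ?_⟩
  · obtain ⟨a, ha⟩ := h.1 (e ⁻¹' s)
    exact ⟨e a, e.isLUB_preimage.1 ha⟩
  · obtain ⟨s, hs, hsb⟩ := h.2 (e.symm b)
    refine ⟨e '' s, ?_, e.isLUB_image.2 hsb⟩
    rintro _ ⟨c, hc, rfl⟩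
    exact e.isCompactElement_apply (hs c hc)

theorem isCompletelyJoinIrreducible_apply (e : A ≃o B) {j : A}
    (hj : IsCompletelyJoinIrreducible j) : IsCompletelyJoinIrreducible (e j) :=
  fun X hX => hj (e ⁻¹' X) (e.isLUB_preimage.2 hX)

end OrderIso

namespace NelsonEquiv

variable {A : Type u} {B : Type v} [NelsonAlgebra A] [NelsonAlgebra B]

theorem isNelsonG_apply_iff (e : NelsonEquiv A B) {j i : A} :
    IsNelsonG (e.toOrderIso j) (e.toOrderIso i) ↔ IsNelsonG j i := by
  rw [IsNelsonG, ← e.toOrderIso.isGLB_preimage, IsNelsonG]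
  have hsnot : NelsonAlgebra.snot (e.toOrderIso j) = e.toOrderIso (NelsonAlgebra.snot j) :=
    (e.map_snot j).symm
  simp only [hsnot, Set.preimage_ofPred_eq, OrderIso.le_iff_le]

end NelsonEquiv

/-! ### The characterization of effective rough set algebras -/

theorem mainTheorem1 (A : Type u) [NelsonAlgebra A] :
    (∃ (U : Type u) (R : U → U → Prop) (_ : IsPreorder U R),
        RoughSet.IsEffective R ∧ Nonempty (NelsonEquiv A (RoughSet.IRS R))) ↔
      (IsAlgebraicLattice A ∧
        ∀ j : A, IsCompletelyJoinIrreducible j →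
          ∃ k : A, IsCompletelyJoinIrreducible k ∧ IsNelsonG k k ∧ (j ≤ k ∨ k ≤ j)) := by
  constructor
  · rintro ⟨U, R, _, heff, ⟨e⟩⟩
    let f := e.toOrderIso
    refine ⟨f.symm.isAlgebraicLattice (RoughSet.IRS.isAlgebraicLattice R), fun j hj => ?_⟩
    obtain ⟨k, hk, hkk, hjk⟩ := RoughSet.IRS.exists_comparable_of_isEffective heff
      (f.isCompletelyJoinIrreducible_apply hj)
    refine ⟨f.symm k, f.symm.isCompletelyJoinIrreducible_apply hk, ?_,
      hjk.imp f.le_symm_apply.2 f.symm_apply_le.2⟩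
    rw [← e.isNelsonG_apply_iff]
    exact (f.apply_symm_apply k).symm ▸ hkk
  · rintro ⟨h, hg⟩
    exact ⟨NelsonAlgebra.Irr A, NelsonAlgebra.Irr.rel, inferInstance,
      NelsonAlgebra.isEffective_rel h hg, ⟨NelsonAlgebra.equivIRS h⟩⟩
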